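/- Let $(\Omega,\mathcal F,\mathbb P)$ be a nonatomic probability space and write $L^p=L^p(\Omega,\mathcal F,\mathbb P)$ (real-valued, almost sure order) for $1\le p\le\infty$. An acceptance set in $L^p$ is a nonempty, proper subset $\mathcal B\subset L^p$ such that $X+Z\in\mathcal B$ for all $X\in\mathcal B$ and all $Z\in L^p$ with $Z\ge 0$; a traded asset in $L^p$ is a pair $R=(R_0,R_T)$ with $R_0>0$ and $0\neq R_T\in L^p$, $R_T\ge 0$. The associated risk measure on $L^p$ is the map $\rho_{\mathcal B,R}:L^p\to[-\infty,\infty]$, $$\rho_{\mathcal B,R}(X)=\inf\Big\{m\in\mathbb R:\ X+\frac{m}{R_0}R_T\in\mathcal B\Big\},\qquad \inf\emptyset=+\infty .$$ A set $\mathcal A\subset L^\infty$ is law-invariant if $X\in\mathcal A$ whenever $X\in L^\infty$ has the same law as some $Y\in\mathcal A$. Write $\mathrm{cl}_\infty(\mathcal A)$ for the norm closure of $\mathcal A$ in $L^\infty$ and $\mathrm{cl}_p(\mathcal A)$ for its norm closure in $L^p$. Theorem 4.3. Let $\mathcal A\subset L^\infty$ be a convex, law-invariant acceptance set and let $S=(S_0,S_T)$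 be a traded asset in $L^\infty$ such that $\rho_{\mathcal A,S}$ is finite-valued on $L^\infty$. Then $\rho_{\mathcal A,S}$ is continuous on $L^\infty$. Moreover, for every $1\le p<\infty$, each finite-valued risk measure $\rho_{\mathcal B,R}$ on $L^p$ with convex $\mathcal B$ is continuous, and the following statements are equivalent: (a) $\rho_{\mathcal A,S}$ can be extended to a finite-valued, continuous risk measure on $L^p$, i.e. there are an acceptance set $\mathcal B\subset L^p$ and a traded asset $R$ in $L^p$ such that $\rho_{\mathcal B,R}$ is finite-valued and continuous on $L^p$ and coincides with $\rho_{\mathcal A,S}$ on $L^\infty$; (b) if $(X_n)\subset L^\infty$ and $X_n\to 0$ in $L^p$, then $\rho_{\mathcal A,S}(X_n)\to\rho_{\mathcal A,S}(0)$; (c) $\mathrm{cl}_\infty(\mathcal A)$ has nonempty interior in $L^\infty$ with respect to the topology induced by $L^p$; (d) $\mathrm{cl}_p(\mathcal A)$ has nonempty interior in $L^p$. In this case, the finite-valued, continuous risk measure on $L^p$ extending $\rho_{\mathcal A,S}$ is unique and is given by $\rho_{\mathrm{cl}_p(\mathcal A),S}$. -/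

import Mathlib

open MeasureTheory ProbabilityTheory Filter Topology
open scoped ENNReal

noncomputable section

namespace LawInvariantRisk

/-- A measure is nonatomic if every measurable set of positive measure contains a measurable
subset of strictly smaller positive measure. (This is not a condition on singletons.) -/
def IsNonatomic {Ω : Type*} [MeasurableSpace Ω] (μ : Measure Ω) : Prop :=
  ∀ s : Set Ω, MeasurableSet s → 0 < μ s →
    ∃ t : Set Ω, t ⊆ s ∧ MeasurableSet t ∧ 0 < μ t ∧ μ t < μ s

section Ordered

variable {E : Type*} [AddCommGroup E] [Module ℝ E] [PartialOrder E]

/-- An acceptance set: a nonempty, proper subset that is stable under adding positive elements. -/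
structure IsAcceptanceSet (A : Set E) : Prop where
  nonempty : A.Nonempty
  proper : A ≠ Set.univ
  add_mem : ∀ X ∈ A, ∀ Z : E, 0 ≤ Z → X + Z ∈ A

/-- A traded asset `(S₀, S_T)`: price `S₀ > 0` and nonzero positive payoff `S_T`. -/
structure IsTradedAsset (S₀ : ℝ) (ST : E) : Prop where
  price_pos : 0 < S₀
  payoff_nonneg : 0 ≤ ST
  payoff_ne_zero : ST ≠ 0

/-- `ρ_{A,S}(X) = inf {m ∈ ℝ ; X + (m / S₀) S_T ∈ A}`, as an extended real number
(so that the infimum of the empty set is `+∞`). -/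
def riskMeasure {E : Type*} [AddCommGroup E] [Module ℝ E]
    (A : Set E) (S₀ : ℝ) (ST : E) (X : E) : EReal :=
  ⨅ m ∈ {m : ℝ | X + (m / S₀) • ST ∈ A}, (m : EReal)

/-- A risk measure on `E`: a map of the form `ρ_{B,R}` for some acceptance set `B ⊆ E` and some
traded asset `R` with payoff in `E`. -/
def IsRiskMeasure (f : E → EReal) : Prop :=
  ∃ (B : Set E) (R₀ : ℝ) (RT : E),
    IsAcceptanceSet B ∧ IsTradedAsset R₀ RT ∧ f = riskMeasure B R₀ RT

end Ordered

/-- The map `f` takes only real values. -/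
def IsFiniteValued {E : Type*} (f : E → EReal) : Prop :=
  ∀ X, f X ≠ ⊥ ∧ f X ≠ ⊤

section Lp

variable {Ω : Type*} [MeasurableSpace Ω] {μ : Measure Ω}

/-- A set of random variables is law-invariant if it contains, with `Y`, every element
having the same law as `Y`. -/
def IsLawInvariant {p : ℝ≥0∞} (A : Set (Lp ℝ p μ)) : Prop :=
  ∀ X Y : Lp ℝ p μ, Y ∈ A → IdentDistrib X Y μ μ → X ∈ A

/-- The canonical inclusion of `L^∞` into `L^p` over a finite measure. -/
def inclLp (μ : Measure Ω) [IsFiniteMeasure μ] (p : ℝ≥0∞) : Lp ℝ ∞ μ →+ Lp ℝ p μ :=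
  AddSubgroup.inclusion (Lp.antitone (E := ℝ) (μ := μ) (le_top : p ≤ ∞))

/-- The `L^p`-topology on `L^∞`, that is, the relative topology induced by `L^p`. -/
abbrev lpTopology (μ : Measure Ω) [IsFiniteMeasure μ] (p : ℝ≥0∞) [Fact (1 ≤ p)] :
    TopologicalSpace (Lp ℝ ∞ μ) :=
  TopologicalSpace.induced (inclLp μ p) inferInstance

/-- The closure in `L^p` of a subset of `L^∞`. -/
def closureLp [IsFiniteMeasure μ] (p : ℝ≥0∞) [Fact (1 ≤ p)] (A : Set (Lp ℝ ∞ μ)) :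
    Set (Lp ℝ p μ) :=
  closure (inclLp μ p '' A)

/-- `f` is a finite-valued, continuous risk measure on `L^p` which extends the map `ρ`
defined on `L^∞`. -/
structure IsFiniteContinuousExtension [IsFiniteMeasure μ] {p : ℝ≥0∞} [Fact (1 ≤ p)]
    (ρ : Lp ℝ ∞ μ → EReal) (f : Lp ℝ p μ → EReal) : Prop where
  isRiskMeasure : IsRiskMeasure f
  finite : IsFiniteValued f
  continuous : Continuous f
  extends_on : ∀ X : Lp ℝ ∞ μ, f (inclLp μ p X) = ρ X

end Lp

end LawInvariantRisk

end

/-!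
The only place where the law-invariance of `A` matters is the identity
`cl_p(A) ∩ L^∞ = cl_∞(A)` (`mem_closure_of_incl_mem_closureLp`); the rest is convex analysis.

**Closures.** Let `Y ∈ A` be close in `L^p`, hence in `L^1`, to a bounded `X`, and cut `Ω` into
finitely many cells on which `X` is almost constant. The means of `Y` over the cells of positive
probability are close to the values of `X`. By `exists_mem_le_means`, the set `A` contains an
element that is on each cell at most the mean of `Y` plus `ε`; as `A` is stable under adding
positive elements, it contains an element uniformly close to `X`. The element is obtained by
rearranging `Y` on one cell `G` at a time. A nonatomic space carries a uniform variable `U` on `G`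
(`exists_uniform`, by way of a maximal chain of events). If `q` is the quantile function of `Y` on
`G`, then all rotations `q (fract (U + j / N))`, continued by `Y` off `G`, have the law of `Y`, so
that they lie in `A` together with their average over `j < N`. As `q` is monotone, this average is
constant on `G` up to `O(1 / N)`, and its mean is that of `Y` (`exists_rearrangements`).

**Automatic continuity.** A finite-valued risk measure with convex acceptance set is a convex
antitone function on a Banach lattice, so it is continuous by the extended Namioka–Klee theorem
(`continuous_of_convexOn_antitone`).

**Extension.** By continuity on `L^∞`, the acceptance sets `A` and `cl_∞(A)` define the same risk
measure, so by the identity of closures `ρ_{cl_p(A),S}` extends `ρ_{A,S}`. If `cl_p(A)` has an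
interior point, convexity and the density of `L^∞` make this extension finite on `L^p`
(`isFiniteValued_riskMeasure_closureLp`), and then it is continuous. Conversely, a continuous
extension makes `ρ_{A,S}` continuous at `0` for the `L^p`-norm, which yields a relative `L^p`-ball
in `A` (`lpTopology_interior_nonempty`), and by density a ball in `cl_p(A)`. Uniqueness is again
the density of `L^∞` in `L^p`.
-/

namespace LawInvariantRisk

/-! ### Risk measures on ordered vector spaces -/

section Ordered

theorem IsAcceptanceSet.mem_of_le {E : Type*} [AddCommGroup E] [PartialOrder E]
    [IsOrderedAddMonoid E] {A : Set E} (hA : IsAcceptanceSet A) {X Y : E} (hX : X ∈ A)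
    (h : X ≤ Y) : Y ∈ A := by
  simpa using hA.add_mem X hX (Y - X) (sub_nonneg.2 h)

variable {E : Type*} [AddCommGroup E] [Module ℝ E]

theorem riskMeasure_le_of_mem {A : Set E} {S₀ : ℝ} {ST X : E} {m : ℝ}
    (h : X + (m / S₀) • ST ∈ A) : riskMeasure A S₀ ST X ≤ m :=
  iInf₂_le m h

theorem exists_mem_of_riskMeasure_lt {A : Set E} {S₀ : ℝ} {ST X : E} {c : EReal}
    (h : riskMeasure A S₀ ST X < c) : ∃ m : ℝ, (m : EReal) < c ∧ X + (m / S₀) • ST ∈ A := by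
  simp only [riskMeasure, iInf_lt_iff, Set.mem_ofPred_eq] at h
  obtain ⟨m, hm, hc⟩ := h
  exact ⟨m, hc, hm⟩

/-- Subtracting the payoff of `m / S₀` units of the asset raises the capital requirement by at
least `m`. -/
theorem add_le_riskMeasure_sub (A : Set E) {S₀ : ℝ} (ST X : E) (m r : ℝ)
    (h : (r : EReal) ≤ riskMeasure A S₀ ST X) :
    ((r + m : ℝ) : EReal) ≤ riskMeasure A S₀ ST (X - (m / S₀) • ST) := by
  refine le_iInf₂ fun m' hm' => ?_
  have h1 : X + ((m' - m) / S₀) • ST ∈ A := by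
    have h2 : X - (m / S₀) • ST + (m' / S₀) • ST ∈ A := hm'
    rwa [show X + ((m' - m) / S₀) • ST = X - (m / S₀) • ST + (m' / S₀) • ST by
      rw [sub_div, sub_smul]; abel]
  have h2 := h.trans (riskMeasure_le_of_mem h1)
  have h3 : r ≤ m' - m := by exact_mod_cast h2
  exact_mod_cast (by linarith : r + m ≤ m')

theorem combo_mem {A : Set E} (hconv : Convex ℝ A) {S₀ : ℝ} {ST X Y : E} {m n a b : ℝ}
    (hX : X + (m / S₀) • ST ∈ A) (hY : Y + (n / S₀) • ST ∈ A) (ha : 0 ≤ a) (hb : 0 ≤ b)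
    (hab : a + b = 1) : a • X + b • Y + ((a * m + b * n) / S₀) • ST ∈ A := by
  convert hconv hX hY ha hb hab using 1
  simp only [smul_add, smul_smul, add_div, add_smul, mul_div_assoc]
  abel

variable [PartialOrder E] [IsOrderedAddMonoid E]

theorem riskMeasure_antitone {A : Set E} (hA : IsAcceptanceSet A) (S₀ : ℝ) (ST : E) :
    Antitone (riskMeasure A S₀ ST) := by
  intro X Y h
  refine le_iInf₂ fun m hm => riskMeasure_le_of_mem (hA.mem_of_le hm ?_)
  gcongr

variable [IsOrderedModule ℝ E]

theorem mem_of_riskMeasure_lt {A : Set E} (hA : IsAcceptanceSet A) {S₀ : ℝ} {ST : E}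
    (hS : IsTradedAsset S₀ ST) {X : E} {m : ℝ} (h : riskMeasure A S₀ ST X < m) :
    X + (m / S₀) • ST ∈ A := by
  obtain ⟨m', hm', hmem⟩ := exists_mem_of_riskMeasure_lt h
  refine hA.mem_of_le hmem ?_
  have h1 : m' / S₀ ≤ m / S₀ :=
    div_le_div_of_nonneg_right (by exact_mod_cast hm'.le) hS.price_pos.le
  gcongr
  exact hS.payoff_nonneg

/-- A convex acceptance set defines a convex risk measure, here in the form that also covers
the values `±∞`. -/
theorem riskMeasure_combo_lt {A : Set E} (hA : IsAcceptanceSet A) (hconv : Convex ℝ A) {S₀ : ℝ}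
    {ST : E} (hS : IsTradedAsset S₀ ST) {X Y : E} {m n a b : ℝ}
    (hX : riskMeasure A S₀ ST X < m) (hY : riskMeasure A S₀ ST Y < n) (ha : 0 ≤ a) (hb : 0 ≤ b)
    (hab : a + b = 1) : riskMeasure A S₀ ST (a • X + b • Y) ≤ (a * m + b * n : ℝ) :=
  riskMeasure_le_of_mem
    (combo_mem hconv (mem_of_riskMeasure_lt hA hS hX) (mem_of_riskMeasure_lt hA hS hY) ha hb hab)

theorem convexOn_of_riskMeasure_eq_coe {A : Set E} (hA : IsAcceptanceSet A) (hconv : Convex ℝ A)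
    {S₀ : ℝ} {ST : E} (hS : IsTradedAsset S₀ ST) {r : E → ℝ}
    (hr : ∀ X, riskMeasure A S₀ ST X = r X) : ConvexOn ℝ Set.univ r := by
  refine ⟨convex_univ, fun X _ Y _ a b ha hb hab => ?_⟩
  refine le_of_forall_pos_le_add fun ε hε => ?_
  have h := riskMeasure_combo_lt hA hconv hS (X := X) (Y := Y) (m := r X + ε) (n := r Y + ε)
    (by rw [hr]; exact_mod_cast lt_add_of_pos_right _ hε)
    (by rw [hr]; exact_mod_cast lt_add_of_pos_right _ hε) ha hb hab
  rw [hr] at h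
  have h' : r (a • X + b • Y) ≤ a * (r X + ε) + b * (r Y + ε) := by exact_mod_cast h
  have : a * (r X + ε) + b * (r Y + ε) = a * r X + b * r Y + (a + b) * ε := by ring
  simpa [this, hab] using h'

end Ordered

theorem IsFiniteValued.exists_real {E : Type*} {f : E → EReal} (hf : IsFiniteValued f) :
    ∃ r : E → ℝ, ∀ X, f X = r X :=
  ⟨fun X => (f X).toReal, fun X => (EReal.coe_toReal (hf X).2 (hf X).1).symm⟩

/-! ### Automatic continuity of convex monotone functionals -/

section BanachLattice

variable {E : Type*} [NormedAddCommGroup E] [NormedSpace ℝ E] [Lattice E] [HasSolidNorm E]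
  [IsOrderedAddMonoid E] [IsOrderedModule ℝ E] [CompleteSpace E]

/-- The extended Namioka–Klee theorem: a real-valued convex antitone function on a Banach lattice
is continuous. If it were unbounded above near `0`, there would be `X n` with `‖X n‖ < 4⁻ⁿ` and
`n < r (X n)`; but `X n ≥ -2⁻ⁿ Z` for `Z = ∑ 2ⁿ |X n|`, so convexity on the segment from `0`
to `-Z` bounds all `r (X n)`. -/
theorem continuous_of_convexOn_antitone {r : E → ℝ} (hconv : ConvexOn ℝ Set.univ r)
    (hanti : Antitone r) : Continuous r := by
  suffices h : (𝓝 (0 : E)).IsBoundedUnder (· ≤ ·) r by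
    have htfae := (hconv.continuousOn_tfae isOpen_univ Set.univ_nonempty).out 3 1
    exact continuousOn_univ.1 (htfae.1 ⟨0, Set.mem_univ _, h⟩)
  by_contra hub
  have hex : ∀ n : ℕ, ∃ x : E, ‖x‖ < (1 / 4) ^ n ∧ (n : ℝ) < r x := by
    intro n
    by_contra! hcon
    refine hub ⟨n, ?_⟩
    rw [eventually_map]
    filter_upwards [Metric.ball_mem_nhds (0 : E) (by positivity : (0 : ℝ) < (1 / 4) ^ n)] with x hx
    exact hcon x (by simpa using hx)
  choose x hx hxr using hex
  have hsum : Summable fun n : ℕ => (2 : ℝ) ^ n • |x n| := by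
    refine Summable.of_norm_bounded (g := fun n : ℕ => (1 / 2 : ℝ) ^ n)
      (summable_geometric_of_lt_one (by norm_num) (by norm_num)) fun n => ?_
    rw [norm_smul, norm_abs_eq_norm, Real.norm_of_nonneg (by positivity)]
    calc (2 : ℝ) ^ n * ‖x n‖ ≤ 2 ^ n * (1 / 4) ^ n := by gcongr; exact (hx n).le
      _ = (1 / 2) ^ n := by rw [← mul_pow]; norm_num
  set Z : E := ∑' n, (2 : ℝ) ^ n • |x n|
  have hZ : ∀ n, (2 : ℝ) ^ n • |x n| ≤ Z := fun n =>
    hsum.le_tsum n fun j _ => smul_nonneg (by positivity) (abs_nonneg _)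
  have hlow : ∀ n, (1 / 2 : ℝ) ^ n • (-Z) ≤ x n := by
    intro n
    have h1 : (1 / 2 : ℝ) ^ n • (2 : ℝ) ^ n • |x n| ≤ (1 / 2 : ℝ) ^ n • Z :=
      smul_le_smul_of_nonneg_left (hZ n) (by positivity)
    rw [smul_smul, ← mul_pow] at h1
    norm_num at h1
    rw [smul_neg]
    exact (neg_le_neg (by simpa using h1)).trans (neg_le.1 (neg_le_abs _))
  have hbd : ∀ n, r (x n) ≤ max (r (-Z)) (r 0) := by
    intro n
    have hpow : (1 / 2 : ℝ) ^ n ≤ 1 := pow_le_one₀ (by norm_num) (by norm_num)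
    have h2 := hconv.2 (Set.mem_univ (-Z)) (Set.mem_univ 0)
      (by positivity : (0 : ℝ) ≤ (1 / 2) ^ n) (sub_nonneg.2 hpow) (by ring)
    rw [smul_zero, add_zero] at h2
    refine (hanti (hlow n)).trans (h2.trans ?_)
    have ha := le_max_left (r (-Z)) (r 0)
    have hb := le_max_right (r (-Z)) (r 0)
    have hc : (0 : ℝ) ≤ (1 / 2) ^ n := by positivity
    simp only [smul_eq_mul]
    nlinarith
  obtain ⟨n, hn⟩ := exists_nat_gt (max (r (-Z)) (r 0))
  exact absurd ((hxr n).trans_le (hbd n)) (not_lt.2 hn.le)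

theorem continuous_riskMeasure_of_finite {A : Set E} (hA : IsAcceptanceSet A)
    (hconv : Convex ℝ A) {S₀ : ℝ} {ST : E} (hS : IsTradedAsset S₀ ST)
    (hfin : IsFiniteValued (riskMeasure A S₀ ST)) : Continuous (riskMeasure A S₀ ST) := by
  obtain ⟨r, hr⟩ := hfin.exists_real
  have hanti : Antitone r := fun X Y h => by
    have := riskMeasure_antitone hA S₀ ST h
    rw [hr, hr] at this
    exact_mod_cast this
  rw [show riskMeasure A S₀ ST = fun X => (r X : EReal) from funext hr]
  exact continuous_coe_real_ereal.comp
    (continuous_of_convexOn_antitone (convexOn_of_riskMeasure_eq_coe hA hconv hS hr) hanti)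

end BanachLattice

section LpOrder

variable {Ω : Type*} [MeasurableSpace Ω] {μ : Measure Ω}

instance instIsOrderedModuleLp {p : ℝ≥0∞} : IsOrderedModule ℝ (Lp ℝ p μ) where
  smul_le_smul_of_nonneg_left a ha f g hfg := by
    rw [← Lp.coeFn_le] at hfg ⊢
    filter_upwards [hfg, Lp.coeFn_smul a f, Lp.coeFn_smul a g] with x h h1 h2
    rw [h1, h2]
    exact mul_le_mul_of_nonneg_left h ha
  smul_le_smul_of_nonneg_right f hf a b hab := by
    rw [← Lp.coeFn_nonneg] at hf
    rw [← Lp.coeFn_le]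
    filter_upwards [hf, Lp.coeFn_smul a f, Lp.coeFn_smul b f] with x h h1 h2
    rw [h1, h2]
    exact mul_le_mul_of_nonneg_right hab h

end LpOrder

/-! ### Uniform random variables on a nonatomic space -/

section Nonatomic

variable {Ω : Type*} [MeasurableSpace Ω]

/-- Strict inclusion of measurable sets that is also strict for the measure. Chains for this
relation contain at most one set of each measure, so null sets do not interfere with
maximality. -/
def MeasureLT (P : Measure Ω) (s t : {s : Set Ω // MeasurableSet s}) : Prop :=
  s.1 ⊆ t.1 ∧ P.real s.1 < P.real t.1

/-- The union of a chain of measurable sets, strictly ordered also by the measure, is measurable: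
it is the union of countably many of its members. -/
theorem sUnion_chain {P : Measure Ω} [IsFiniteMeasure P] {L : Set {s : Set Ω // MeasurableSet s}}
    (hL : IsChain (MeasureLT P) L) {t : ℝ} (ht : 0 ≤ t) (hLt : ∀ s ∈ L, P.real s.1 ≤ t) :
    MeasurableSet (⋃ s ∈ L, s.1) ∧ P.real (⋃ s ∈ L, s.1) ≤ t := by
  rcases L.eq_empty_or_nonempty with rfl | hne
  · simpa using ht
  by_cases hmax : ∃ s ∈ L, ∀ s' ∈ L, P.real s'.1 ≤ P.real s.1
  · obtain ⟨s, hs, hmax⟩ := hmax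
    have : ⋃ s ∈ L, s.1 = s.1 := by
      refine (Set.iUnion₂_subset fun s' hs' => ?_).antisymm (Set.subset_biUnion_of_mem hs)
      rcases eq_or_ne s' s with rfl | hne'
      · exact subset_rfl
      · exact (hL hs' hs hne').elim (fun h => h.1) fun h => absurd h.2 (hmax s' hs').not_gt
    rw [this]
    exact ⟨s.2, hLt s hs⟩
  · push Not at hmax
    obtain ⟨u, -, hu, huS⟩ := exists_seq_tendsto_sSup (hne.image fun s => P.real s.1)
      ⟨t, by rintro _ ⟨s, hs, rfl⟩; exact hLt s hs⟩
    choose a haL hau using huS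
    have hsub : ∀ s ∈ L, ∃ n, s.1 ⊆ (a n).1 := by
      intro s hs
      obtain ⟨s', hs', hlt⟩ := hmax s hs
      have hlt' : P.real s.1 < sSup ((fun s => P.real s.1) '' L) :=
        hlt.trans_le (le_csSup ⟨t, by rintro _ ⟨s, hs, rfl⟩; exact hLt s hs⟩ ⟨s', hs', rfl⟩)
      obtain ⟨n, hn⟩ := (hu.eventually (lt_mem_nhds hlt')).exists
      rw [← hau n] at hn
      refine ⟨n, ?_⟩
      have hne' : s ≠ a n := fun h => by rw [← h] at hn; exact lt_irrefl _ hn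
      exact (hL hs (haL n) hne').elim (fun h => h.1) fun h => absurd h.2 hn.not_gt
    have heq : ⋃ s ∈ L, s.1 = ⋃ n, (a n).1 := by
      refine (Set.iUnion₂_subset fun s hs => ?_).antisymm
        (Set.iUnion_subset fun n => Set.subset_biUnion_of_mem (haL n))
      obtain ⟨n, hn⟩ := hsub s hs
      exact hn.trans (Set.subset_iUnion (fun n => (a n).1) n)
    have hdir : Directed (· ⊆ ·) fun n => (a n).1 := by
      intro m n
      rcases eq_or_ne (a m) (a n) with h | h
      · exact ⟨n, by simp only [h, subset_rfl], subset_rfl⟩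
      · exact (hL (haL m) (haL n) h).elim (fun h => ⟨n, h.1, subset_rfl⟩)
          fun h => ⟨m, subset_rfl, h.1⟩
    rw [heq]
    refine ⟨MeasurableSet.iUnion fun n => (a n).2, ?_⟩
    rw [measureReal_def, hdir.measure_iUnion]
    refine ENNReal.toReal_le_of_le_ofReal ht (iSup_le fun n => ?_)
    rw [← ENNReal.ofReal_toReal (measure_ne_top P (a n).1)]
    exact ENNReal.ofReal_le_ofReal (hLt _ (haL n))

/-- The intersection of such a chain is measurable too, by passing to complements. -/
theorem inter_chain {P : Measure Ω} [IsProbabilityMeasure P]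
    {L : Set {s : Set Ω // MeasurableSet s}} (hL : IsChain (MeasureLT P) L) {t : ℝ} (ht : t ≤ 1)
    (hLt : ∀ s ∈ L, t ≤ P.real s.1) :
    MeasurableSet (⋂ s ∈ L, s.1) ∧ t ≤ P.real (⋂ s ∈ L, s.1) := by
  let c : {s : Set Ω // MeasurableSet s} → {s : Set Ω // MeasurableSet s} := fun s =>
    ⟨s.1ᶜ, s.2.compl⟩
  have hlt : ∀ s s', MeasureLT P s s' → MeasureLT P (c s') (c s) := fun s s' h =>
    ⟨Set.compl_subset_compl.2 h.1, by
      simp only [c, probReal_compl_eq_one_sub s.2, probReal_compl_eq_one_sub s'.2]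
      linarith [h.2]⟩
  have hchain : IsChain (MeasureLT P) (c '' L) := by
    rintro _ ⟨s, hs, rfl⟩ _ ⟨s', hs', rfl⟩ hne
    have hne' : s ≠ s' := fun h => hne (by rw [h])
    exact (hL hs hs' hne').elim (fun h => Or.inr (hlt _ _ h)) fun h => Or.inl (hlt _ _ h)
  obtain ⟨h1, h2⟩ := sUnion_chain hchain (t := 1 - t) (by linarith) (by
    rintro _ ⟨s, hs, rfl⟩
    simp only [c, probReal_compl_eq_one_sub s.2]
    linarith [hLt s hs])
  have heq : ⋃ s ∈ c '' L, s.1 = (⋂ s ∈ L, s.1)ᶜ := by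
    rw [Set.biUnion_image]
    simp only [c, Set.compl_iInter]
  rw [heq] at h1 h2
  have h1' := h1.of_compl
  rw [probReal_compl_eq_one_sub h1'] at h2
  exact ⟨h1', by linarith⟩

/-- A nonatomic probability space carries an increasing family of events with all probabilities
in `[0, 1]`, namely a maximal chain of events: a gap in the probabilities of the chain could be
filled by cutting the difference of the two sets bounding it. -/
theorem exists_increasing_events {P : Measure Ω} [IsProbabilityMeasure P] (hP : IsNonatomic P) :
    ∃ A : ℝ → Set Ω, ∀ t ∈ Set.Icc (0 : ℝ) 1, MeasurableSet (A t) ∧ P.real (A t) = t ∧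
      ∀ s ∈ Set.Icc (0 : ℝ) 1, s < t → A s ⊆ A t := by
  set c : Set {s : Set Ω // MeasurableSet s} := maxChain (MeasureLT P)
  obtain ⟨hc, hcmax⟩ : IsMaxChain (MeasureLT P) c := maxChain_spec
  have hins : ∀ a, (∀ b ∈ c, a ≠ b → MeasureLT P a b ∨ MeasureLT P b a) → a ∈ c := fun a ha => by
    rw [hcmax (hc.insert ha) (Set.subset_insert _ _)]
    exact Set.mem_insert _ _
  have hex : ∀ t ∈ Set.Icc (0 : ℝ) 1, ∃ a ∈ c, P.real a.1 = t := by
    rintro t ⟨ht0, ht1⟩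
    by_contra! hcon
    set L := {a ∈ c | P.real a.1 < t}
    set R := {a ∈ c | t < P.real a.1}
    obtain ⟨hUm, hUt⟩ := sUnion_chain (hc.mono (fun a ha => ha.1 : L ⊆ c)) ht0 fun a ha => ha.2.le
    obtain ⟨hIm, hIt⟩ := inter_chain (hc.mono (fun a ha => ha.1 : R ⊆ c)) ht1 fun a ha => ha.2.le
    set U := ⋃ a ∈ L, a.1
    set I := ⋂ a ∈ R, a.1
    have hLU : ∀ a ∈ L, a.1 ⊆ U := fun a ha => Set.subset_biUnion_of_mem (u := fun a => a.1) ha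
    have hIR : ∀ a ∈ R, I ⊆ a.1 := fun a ha => Set.biInter_subset_of_mem ha
    have hUI : U ⊆ I := by
      refine Set.iUnion₂_subset fun a ha => Set.subset_iInter₂ fun b hb => ?_
      have hlt : P.real a.1 < P.real b.1 := ha.2.trans hb.2
      have hne : a ≠ b := fun h => by rw [h] at hlt; exact lt_irrefl _ hlt
      exact (hc ha.1 hb.1 hne).elim (fun h => h.1) fun h => absurd h.2 hlt.not_gt
    clear_value U I
    have hcase : ∀ b ∈ c, b ∈ L ∨ b ∈ R := fun b hb =>
      (lt_or_gt_of_ne (hcon b hb)).imp (fun h => ⟨hb, h⟩) fun h => ⟨hb, h⟩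
    -- A set between `U` and `I` of measure `t` would belong to the chain.
    have hUlt : P.real U < t := by
      refine lt_of_le_of_ne hUt fun h => hcon ⟨U, hUm⟩ (hins _ fun b hb _ => ?_) h
      rcases hcase b hb with hbL | hbR
      · exact Or.inr ⟨hLU b hbL, by simpa only [h] using hbL.2⟩
      · exact Or.inl ⟨hUI.trans (hIR b hbR), by simpa only [h] using hbR.2⟩
    have hIgt : t < P.real I := by
      refine lt_of_le_of_ne hIt fun h => hcon ⟨I, hIm⟩ (hins _ fun b hb _ => ?_) h.symm
      rcases hcase b hb with hbL | hbR
      · exact Or.inr ⟨(hLU b hbL).trans hUI, by simpa only [← h] using hbL.2⟩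
      · exact Or.inl ⟨hIR b hbR, by simpa only [← h] using hbR.2⟩
    have hD : P.real (I \ U) = P.real I - P.real U := measureReal_sdiff hUI hUm
    obtain ⟨T, hTsub, hTm, hT0, hT1⟩ := hP (I \ U) (hIm.diff hUm) (by
      have : 0 < P.real (I \ U) := by rw [hD]; linarith
      exact (ENNReal.toReal_pos_iff.1 this).1)
    have hT0' : 0 < P.real T := ENNReal.toReal_pos hT0.ne' (measure_ne_top _ _)
    have hT1' : P.real T < P.real (I \ U) :=
      (ENNReal.toReal_lt_toReal (measure_ne_top _ _) (measure_ne_top _ _)).2 hT1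
    have hdisj : Disjoint U T := Set.disjoint_left.2 fun x hx hxT => (hTsub hxT).2 hx
    have hC : P.real (U ∪ T) = P.real U + P.real T := measureReal_union hdisj hTm
    have hCI : U ∪ T ⊆ I := Set.union_subset hUI fun x hx => (hTsub hx).1
    have hmem : (⟨U ∪ T, hUm.union hTm⟩ : {s : Set Ω // MeasurableSet s}) ∈ c := by
      refine hins _ fun b hb _ => ?_
      rcases hcase b hb with hbL | hbR
      · refine Or.inr ⟨(hLU b hbL).trans Set.subset_union_left, ?_⟩
        have := measureReal_mono (μ := P) (hLU b hbL)
        show P.real b.1 < P.real (U ∪ T)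
        linarith
      · refine Or.inl ⟨hCI.trans (hIR b hbR), ?_⟩
        have := measureReal_mono (μ := P) (hIR b hbR)
        show P.real (U ∪ T) < P.real b.1
        linarith
    rcases hcase _ hmem with h | h
    · have := measureReal_mono (μ := P) (hLU _ h)
      have h' : P.real (U ∪ T) ≤ P.real U := this
      linarith
    · have := measureReal_mono (μ := P) (hIR _ h)
      have h' : P.real I ≤ P.real (U ∪ T) := this
      linarith
  choose! a hac hat using hex
  refine ⟨fun t => (a t).1, fun t ht => ⟨(a t).2, hat t ht, fun s hs hst => ?_⟩⟩
  have hne : a s ≠ a t := fun h => hst.ne (by rw [← hat s hs, ← hat t ht, h])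
  exact (hc (hac s hs) (hac t ht) hne).elim (fun h => h.1) fun h =>
    absurd h.2 (by rw [hat s hs, hat t ht]; exact hst.not_gt)

/-- A nonatomic probability space carries a random variable uniformly distributed on `[0, 1)`. -/
theorem exists_uniform {P : Measure Ω} [IsProbabilityMeasure P] (hP : IsNonatomic P) :
    ∃ U : Ω → ℝ, Measurable U ∧ P.map U = volume.restrict (Set.Ico 0 1) := by
  obtain ⟨A, hA⟩ := exists_increasing_events hP
  -- Adding the point `1` makes the infimum range over a nonempty set.
  set S : Ω → Set ℝ := fun ω => {t | t ∈ Set.Icc (0 : ℝ) 1 ∧ (ω ∈ A t ∨ t = 1)}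
  set U : Ω → ℝ := fun ω => sInf (S ω)
  have hS1 : ∀ ω, (1 : ℝ) ∈ S ω := fun ω => ⟨⟨zero_le_one, le_rfl⟩, Or.inr rfl⟩
  have hSb : ∀ ω, BddBelow (S ω) := fun ω => ⟨0, fun t ht => ht.1.1⟩
  have hU0 : ∀ ω, 0 ≤ U ω := fun ω => le_csInf ⟨1, hS1 ω⟩ fun t ht => ht.1.1
  have hU1 : ∀ ω, U ω ≤ 1 := fun ω => csInf_le (hSb ω) (hS1 ω)
  have hle : ∀ t ∈ Set.Icc (0 : ℝ) 1, ∀ ω ∈ A t, U ω ≤ t := fun t ht ω hω =>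
    csInf_le (hSb ω) ⟨ht, Or.inl hω⟩
  have hlt : ∀ ω x, U ω < x → x ≤ 1 → ∃ t ∈ Set.Icc (0 : ℝ) 1, t < x ∧ ω ∈ A t := by
    intro ω x hx hx1
    obtain ⟨t, ht, htx⟩ := exists_lt_of_csInf_lt ⟨1, hS1 ω⟩ hx
    exact ⟨t, ht.1, htx, ht.2.resolve_right (htx.trans_le hx1).ne⟩
  have hUm : Measurable U := by
    refine measurable_of_Iio fun x => ?_
    rcases le_or_gt x 1 with hx1 | hx1
    · have : U ⁻¹' Set.Iio x = ⋃ q : ℚ, ⋃ _ : (q : ℝ) ∈ Set.Icc (0 : ℝ) 1 ∧ (q : ℝ) < x, A q := by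
        ext ω
        simp only [Set.mem_preimage, Set.mem_Iio, Set.mem_iUnion, exists_prop]
        constructor
        · intro h
          obtain ⟨t, ht, htx, hωt⟩ := hlt ω x h hx1
          obtain ⟨q, hq1, hq2⟩ := exists_rat_btwn htx
          have hq : (q : ℝ) ∈ Set.Icc (0 : ℝ) 1 := ⟨ht.1.trans hq1.le, hq2.le.trans hx1⟩
          exact ⟨q, ⟨hq, hq2⟩, (hA q hq).2.2 t ht hq1 hωt⟩
        · rintro ⟨q, ⟨hq, hqx⟩, hω⟩
          exact (hle q hq ω hω).trans_lt hqx
      rw [this]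
      exact MeasurableSet.iUnion fun q => MeasurableSet.iUnion fun hq => (hA q hq.1).1
    · convert MeasurableSet.univ using 1
      ext ω
      simpa using (hU1 ω).trans_lt hx1
  refine ⟨U, hUm, Measure.ext_of_Iic _ _ fun x => ?_⟩
  rw [Measure.map_apply hUm measurableSet_Iic, Measure.restrict_apply measurableSet_Iic]
  rcases lt_or_ge x 0 with hx0 | hx0
  · have h1 : U ⁻¹' Set.Iic x = ∅ := by
      ext ω; simpa using hx0.trans_le (hU0 ω)
    have h2 : Set.Iic x ∩ Set.Ico (0 : ℝ) 1 = ∅ := by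
      refine Set.eq_empty_of_forall_notMem fun y hy => ?_
      exact absurd (hy.2.1.trans hy.1) hx0.not_ge
    rw [h1, h2]; simp
  rcases le_or_gt 1 x with hx1 | hx1
  · have h1 : U ⁻¹' Set.Iic x = Set.univ := by
      ext ω; simpa using (hU1 ω).trans hx1
    have h2 : Set.Iic x ∩ Set.Ico (0 : ℝ) 1 = Set.Ico 0 1 := by
      ext y; simp only [Set.mem_inter_iff, Set.mem_Iic, Set.mem_Ico]
      exact ⟨fun h => h.2, fun h => ⟨by linarith, h⟩⟩
    rw [h1, h2]; simp
  · have h2 : Set.Iic x ∩ Set.Ico (0 : ℝ) 1 = Set.Icc 0 x := by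
      ext y; simp only [Set.mem_inter_iff, Set.mem_Iic, Set.mem_Ico, Set.mem_Icc]
      exact ⟨fun h => ⟨h.2.1, h.1⟩, fun h => ⟨h.2, h.1, h.2.trans_lt hx1⟩⟩
    rw [h2, Real.volume_Icc, sub_zero, ← ENNReal.ofReal_toReal (measure_ne_top P _)]
    congr 1
    change P.real (U ⁻¹' Set.Iic x) = x
    have hxI : x ∈ Set.Icc (0 : ℝ) 1 := ⟨hx0, hx1.le⟩
    refine le_antisymm (le_of_forall_gt_imp_ge_of_dense fun t ht => ?_) ?_
    · rcases le_or_gt t 1 with ht1 | ht1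
      · have htI : t ∈ Set.Icc (0 : ℝ) 1 := ⟨hx0.trans ht.le, ht1⟩
        rw [← (hA t htI).2.1]
        refine measureReal_mono fun ω hω => ?_
        obtain ⟨s, hs, hst, hωs⟩ := hlt ω t (lt_of_le_of_lt hω ht) ht1
        exact (hA t htI).2.2 s hs hst hωs
      · exact measureReal_le_one.trans ht1.le
    · calc x = P.real (A x) := (hA x hxI).2.1.symm
        _ ≤ _ := measureReal_mono fun ω hω => hle x hxI ω hω

theorem IsNonatomic.cond {P : Measure Ω} [IsFiniteMeasure P] (hP : IsNonatomic P) {G : Set Ω}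
    (hG : MeasurableSet G) (hG0 : P G ≠ 0) : IsNonatomic P[|G] := by
  intro s hs h
  rw [cond_apply hG] at h
  have hpos : 0 < P (G ∩ s) := pos_iff_ne_zero.2 fun h0 => by simp [h0] at h
  obtain ⟨t, hts, ht, h1, h2⟩ := hP _ (hG.inter hs) hpos
  have hGt : G ∩ t = t := Set.inter_eq_right.2 fun x hx => (hts hx).1
  have hinv : (P G)⁻¹ ≠ 0 := ENNReal.inv_ne_zero.2 (measure_ne_top _ _)
  have hinv' : (P G)⁻¹ ≠ ∞ := ENNReal.inv_ne_top.2 hG0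
  refine ⟨t, fun x hx => (hts hx).2, ht, ?_, ?_⟩
  · rw [cond_apply hG, hGt]
    exact ENNReal.mul_pos hinv h1.ne'
  · rw [cond_apply hG, cond_apply hG, hGt]
    exact (ENNReal.mul_lt_mul_iff_right hinv hinv').2 h2

end Nonatomic

/-! ### Quantile functions and rotations -/

section Rearrangement

/-- Rotations of the circle `[0, 1)` preserve the uniform law. -/
theorem map_fract_add {c : ℝ} (hc0 : 0 ≤ c) (hc1 : c ≤ 1) :
    (volume.restrict (Set.Ico (0 : ℝ) 1)).map (fun u => Int.fract (u + c)) =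
      volume.restrict (Set.Ico (0 : ℝ) 1) := by
  have hm : Measurable fun u : ℝ => Int.fract (u + c) := (measurable_id.add_const c).fract
  ext B hB
  rw [Measure.map_apply hm hB, Measure.restrict_apply (hm hB), Measure.restrict_apply hB]
  set S : Set ℝ := Int.fract ⁻¹' B
  have hS : MeasurableSet S := measurable_fract hB
  -- The measure of the `ℤ`-invariant set `S` within one period does not depend on the period.
  have h1 : (fun u : ℝ => Int.fract (u + c)) ⁻¹' B ∩ Set.Ico 0 1 =
      (fun u => u + c) ⁻¹' (S ∩ Set.Ico c (1 + c)) := by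
    ext u
    simp [S]
  have h2 : (fun u : ℝ => u + 1) ⁻¹' (S ∩ Set.Ico 1 (1 + c)) = S ∩ Set.Ico 0 c := by
    ext u
    simp [S, add_comm (1 : ℝ) c]
  have h3 : B ∩ Set.Ico (0 : ℝ) 1 = S ∩ Set.Ico 0 1 := by
    ext u
    simp only [Set.mem_inter_iff, S, Set.mem_preimage]
    refine and_congr_left fun hu => ?_
    rw [Int.fract_eq_self.2 hu]
  rw [h1, measure_preimage_add_right, h3, ← Set.Ico_union_Ico_eq_Ico hc1 (by linarith : 1 ≤ 1 + c),
    ← Set.Ico_union_Ico_eq_Ico hc0 hc1, Set.inter_union_distrib_left, Set.inter_union_distrib_left,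
    measure_union _ (hS.inter measurableSet_Ico), measure_union _ (hS.inter measurableSet_Ico),
    ← h2, measure_preimage_add_right, add_comm]
  · exact (Set.Ico_disjoint_Ico_same).mono Set.inter_subset_right Set.inter_subset_right
  · exact (Set.Ico_disjoint_Ico_same).mono Set.inter_subset_right Set.inter_subset_right

/-- A probability measure on `[a, b]` is the law of its (monotone) quantile function under the
uniform law. -/
theorem exists_quantile {ν : Measure ℝ} [IsProbabilityMeasure ν] {a b : ℝ}
    (hν : ν (Set.Icc a b)ᶜ = 0) :
    ∃ q : ℝ → ℝ, Monotone q ∧ (∀ u, q u ∈ Set.Icc a b) ∧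
      (volume.restrict (Set.Ico (0 : ℝ) 1)).map q = ν := by
  have hFa : ∀ x < a, ν (Set.Iic x) = 0 := fun x hx =>
    measure_mono_null (t := (Set.Icc a b)ᶜ)
      (fun y (hy : y ≤ x) hy' => absurd (hy'.1.trans hy) hx.not_ge) hν
  have hFb : ∀ x, b ≤ x → ν (Set.Iic x) = 1 := fun x hx => by
    rw [← prob_compl_eq_zero_iff measurableSet_Iic]
    exact measure_mono_null (t := (Set.Icc a b)ᶜ) (fun y hy hy' => hy (hy'.2.trans hx)) hν
  have hab : a ≤ b := by
    by_contra! h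
    simp [Set.Icc_eq_empty h.not_ge] at hν
  set F := cdf ν
  have hF : ∀ x, ENNReal.ofReal (F x) = ν (Set.Iic x) := fun x => ofReal_cdf ν x
  have hF1 : F b = 1 := by rw [cdf_eq_real, measureReal_def, hFb b le_rfl, ENNReal.toReal_one]
  -- Truncating `u` at `1` keeps these sets nonempty and the quantile function monotone on `ℝ`.
  set S : ℝ → Set ℝ := fun u => {x | x ∈ Set.Icc a b ∧ min u 1 ≤ F x}
  set q : ℝ → ℝ := fun u => sInf (S u)
  have hbS : ∀ u, b ∈ S u := fun u => ⟨⟨hab, le_rfl⟩, by rw [hF1]; exact min_le_right _ _⟩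
  have hSb : ∀ u, BddBelow (S u) := fun u => ⟨a, fun x hx => hx.1.1⟩
  have hqa : ∀ u, a ≤ q u := fun u => le_csInf ⟨b, hbS u⟩ fun x hx => hx.1.1
  have hqb : ∀ u, q u ≤ b := fun u => csInf_le (hSb u) (hbS u)
  have hmono : Monotone q := fun u v huv => csInf_le_csInf (hSb u) ⟨b, hbS v⟩ fun x hx =>
    ⟨hx.1, (min_le_min_right 1 huv).trans hx.2⟩
  have hgal : ∀ u ≤ 1, ∀ x ∈ Set.Icc a b, q u ≤ x ↔ u ≤ F x := by
    intro u hu x hx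
    constructor
    · intro h
      refine le_trans ?_ (monotone_cdf ν h)
      rw [← StieltjesFunction.iInf_Ioi_eq (cdf ν) (q u)]
      refine le_ciInf fun y => ?_
      obtain ⟨s, hs, hsy⟩ := exists_lt_of_csInf_lt ⟨b, hbS u⟩ y.2
      have := hs.2
      rw [min_eq_left hu] at this
      exact this.trans (monotone_cdf ν hsy.le)
    · exact fun h => csInf_le (hSb u) ⟨hx, by rwa [min_eq_left hu]⟩
  refine ⟨q, hmono, fun u => ⟨hqa u, hqb u⟩, Measure.ext_of_Iic _ _ fun x => ?_⟩
  rw [Measure.map_apply hmono.measurable measurableSet_Iic, restrict_Ico_eq_restrict_Icc,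
    Measure.restrict_apply (hmono.measurable measurableSet_Iic)]
  rcases lt_or_ge x a with hxa | hxa
  · rw [hFa x hxa]
    convert measure_empty (μ := (volume : Measure ℝ))
    exact Set.eq_empty_of_forall_notMem fun u hu => absurd ((hqa u).trans hu.1) hxa.not_ge
  rcases le_or_gt b x with hxb | hxb
  · rw [hFb x hxb]
    have : q ⁻¹' Set.Iic x ∩ Set.Icc (0 : ℝ) 1 = Set.Icc 0 1 :=
      Set.inter_eq_right.2 fun u _ => (hqb u).trans hxb
    rw [this, Real.volume_Icc]; simp
  · have : q ⁻¹' Set.Iic x ∩ Set.Icc (0 : ℝ) 1 = Set.Icc 0 (F x) := by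
      ext u
      simp only [Set.mem_inter_iff, Set.mem_preimage, Set.mem_Iic, Set.mem_Icc]
      constructor
      · rintro ⟨h, h0, h1⟩
        exact ⟨h0, (hgal u h1 x ⟨hxa, hxb.le⟩).1 h⟩
      · rintro ⟨h0, h⟩
        have h1 := h.trans (cdf_le_one ν x)
        exact ⟨(hgal u h1 x ⟨hxa, hxb.le⟩).2 h, h0, h1⟩
    rw [this, Real.volume_Icc, sub_zero, hF]

/-- The sum of a monotone function over the `N` equally spaced rotations of a point of the circle
depends on that point only up to the oscillation of the function: the two sets of rotated points
interlace. -/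
theorem sum_rotations_le {q : ℝ → ℝ} (hq : Monotone q) {a b : ℝ} (hqab : ∀ u, q u ∈ Set.Icc a b)
    {N : ℕ} (hN : 0 < N) (u v : ℝ) :
    ∑ j ∈ Finset.range N, q (Int.fract (u + j / N)) ≤
      ∑ j ∈ Finset.range N, q (Int.fract (v + j / N)) + (b - a) := by
  have hN' : (0 : ℝ) < N := by exact_mod_cast hN
  set f : ℝ → ℝ := fun u => ∑ j ∈ Finset.range N, q (Int.fract (u + j / N))
  have hper : Function.Periodic f (1 / N : ℝ) := by
    intro w
    have hshift : f (w + 1 / N) = ∑ j ∈ Finset.range N, q (Int.fract (w + (j + 1 : ℕ) / N)) := by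
      refine Finset.sum_congr rfl fun j _ => ?_
      congr 2; push_cast; ring
    rw [hshift]
    have h1 := Finset.sum_range_succ (fun j : ℕ => q (Int.fract (w + j / N))) N
    have h2 := Finset.sum_range_succ' (fun j : ℕ => q (Int.fract (w + j / N))) N
    have h3 : q (Int.fract (w + (N : ℕ) / N)) = q (Int.fract (w + (0 : ℕ) / N)) := by
      rw [div_self hN'.ne', Int.fract_add_one]; simp
    simp only [f]
    linarith
  have hred : ∀ w, ∃ w' : ℝ, 0 ≤ w' ∧ w' < 1 / N ∧
      f w = ∑ j ∈ Finset.range N, q (w' + j / N) := by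
    intro w
    have h0 := Int.fract_nonneg (w * N)
    have h1 := Int.fract_lt_one (w * N)
    refine ⟨Int.fract (w * N) / N, by positivity, by gcongr, ?_⟩
    have hw : w = Int.fract (w * N) / N + ⌊w * N⌋ * (1 / N : ℝ) := by
      field_simp
      linarith [Int.floor_add_fract (w * N)]
    conv_lhs => rw [hw, (hper.int_mul ⌊w * N⌋) _]
    refine Finset.sum_congr rfl fun j hj => ?_
    rw [Int.fract_eq_self.2]
    have hj' : (j : ℝ) + 1 ≤ N := by exact_mod_cast Finset.mem_range.1 hj
    refine ⟨by positivity, ?_⟩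
    rw [← add_div, div_lt_one hN']
    linarith
  obtain ⟨u', hu0, hu1, hu⟩ := hred u
  obtain ⟨v', hv0, hv1, hv⟩ := hred v
  change f u ≤ f v + (b - a)
  rw [hu, hv]
  have hstep : ∑ j ∈ Finset.range N, q (u' + j / N) ≤
      ∑ j ∈ Finset.range N, q (v' + (j + 1 : ℕ) / N) := by
    refine Finset.sum_le_sum fun j _ => hq ?_
    push_cast
    rw [add_div]
    linarith
  have h1 := Finset.sum_range_succ (fun j : ℕ => q (v' + j / N)) N
  have h2 := Finset.sum_range_succ' (fun j : ℕ => q (v' + j / N)) N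
  have h3 := (hqab (v' + (N : ℕ) / N)).2
  have h4 := (hqab (v' + (0 : ℕ) / N)).1
  linarith

variable {Ω : Type*} [MeasurableSpace Ω]

/-- On an event `G`, a bounded random variable `Y` has `N` rearrangements, all with the law of `Y`
and equal to `Y` off `G`, whose average is on `G` at most the mean of `Y` over `G`, up to
`(b - a) / N`. They are the rotations `q (fract (U + j / N))` for `U` uniform on `G` and `q` the
quantile function of `Y` on `G`. -/
theorem exists_rearrangements {μ : Measure Ω} [IsProbabilityMeasure μ] (hμ : IsNonatomic μ)
    {G : Set Ω} (hG : MeasurableSet G) (hG0 : μ G ≠ 0) {Y : Ω → ℝ} (hY : Measurable Y) {a b : ℝ}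
    (hYab : ∀ᵐ ω ∂μ, Y ω ∈ Set.Icc a b) {N : ℕ} (hN : 0 < N) :
    ∃ Z : ℕ → Ω → ℝ, (∀ j, j < N → IdentDistrib (Z j) Y μ μ) ∧ (∀ j, ∀ ω ∉ G, Z j ω = Y ω) ∧
      ∀ ω ∈ G, ∑ j ∈ Finset.range N, Z j ω ≤ N * ∫ ω, Y ω ∂μ[|G] + (b - a) := by
  classical
  have : IsProbabilityMeasure μ[|G] := cond_isProbabilityMeasure hG0
  obtain ⟨U, hU, hUlaw⟩ := exists_uniform (hμ.cond hG hG0)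
  have hac : μ[|G] ≪ μ := cond_absolutelyContinuous
  have : IsProbabilityMeasure (μ[|G].map Y) := Measure.isProbabilityMeasure_map hY.aemeasurable
  obtain ⟨q, hq, hqab, hqlaw⟩ := exists_quantile (ν := μ[|G].map Y) (a := a) (b := b) (by
    rw [Measure.map_apply hY measurableSet_Icc.compl]
    exact hac.ae_le hYab)
  have hN' : (0 : ℝ) < N := by exact_mod_cast hN
  set W : ℕ → Ω → ℝ := fun j ω => q (Int.fract (U ω + j / N))
  have hrot : ∀ j : ℕ, Measurable fun u : ℝ => Int.fract (u + j / N) := fun j =>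
    (measurable_id.add_const _).fract
  have hWm : ∀ j, Measurable (W j) := fun j => hq.measurable.comp ((hrot j).comp hU)
  have hWlaw : ∀ j, j < N → μ[|G].map (W j) = μ[|G].map Y := by
    intro j hj
    have hc1 : (j : ℝ) / N ≤ 1 := by
      rw [div_le_one hN']; exact_mod_cast hj.le
    rw [← hqlaw, ← map_fract_add (c := (j : ℝ) / N) (by positivity) hc1, ← hUlaw,
      Measure.map_map (hrot j) hU, Measure.map_map hq.measurable ((hrot j).comp hU)]
    rfl
  refine ⟨fun j ω => if ω ∈ G then W j ω else Y ω, fun j hj => ?_, fun j ω hω => if_neg hω,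
    fun ω hω => ?_⟩
  · have hm : Measurable fun ω => if ω ∈ G then W j ω else Y ω := (hWm j).ite hG hY
    refine ⟨hm.aemeasurable, hY.aemeasurable, ?_⟩
    ext B hB
    rw [Measure.map_apply hm hB, Measure.map_apply hY hB, ← measure_inter_add_sdiff _ hG,
      ← measure_inter_add_sdiff (Y ⁻¹' B) hG]
    congr 1
    · have h1 : (fun ω => if ω ∈ G then W j ω else Y ω) ⁻¹' B ∩ G = G ∩ W j ⁻¹' B := by
        ext ω
        by_cases h : ω ∈ G <;> simp [h]
      have h2 : μ[|G] (W j ⁻¹' B) = μ[|G] (Y ⁻¹' B) := by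
        rw [← Measure.map_apply (hWm j) hB, ← Measure.map_apply hY hB, hWlaw j hj]
      rw [h1, Set.inter_comm _ G, ← cond_mul_eq_inter hG, h2, cond_mul_eq_inter hG]
    · congr 1
      ext ω
      by_cases h : ω ∈ G <;> simp [h]
  · simp only [if_pos hω]
    have hWint : ∀ j, Integrable (W j) μ[|G] := fun j =>
      Integrable.of_mem_Icc a b (hWm j).aemeasurable (Eventually.of_forall fun ω => hqab _)
    have hWmean : ∀ j ∈ Finset.range N, ∫ ω, W j ω ∂μ[|G] = ∫ ω, Y ω ∂μ[|G] := by
      intro j hj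
      have h1 := integral_map (μ := μ[|G]) (hWm j).aemeasurable (f := fun x : ℝ => x)
        aestronglyMeasurable_id
      have h2 := integral_map (μ := μ[|G]) hY.aemeasurable (f := fun x : ℝ => x)
        aestronglyMeasurable_id
      rw [← h1, ← h2, hWlaw j (Finset.mem_range.1 hj)]
    -- Compare with the value at a second point, and integrate over that point.
    have hle : ∫ _, (∑ j ∈ Finset.range N, W j ω - (b - a)) ∂μ[|G] ≤
        ∫ ω', ∑ j ∈ Finset.range N, W j ω' ∂μ[|G] :=
      integral_mono (integrable_const _) (integrable_finsetSum _ fun j _ => hWint j) fun ω' =>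
        by
          have := sum_rotations_le hq hqab hN (U ω) (U ω')
          simp only [W]
          linarith
    rw [integral_const, integral_finsetSum _ fun j _ => hWint j, Finset.sum_congr rfl hWmean] at hle
    simp at hle
    linarith

end Rearrangement

/-! ### Convex law-invariant acceptance sets and closures -/

section Closure

variable {Ω : Type*} [MeasurableSpace Ω] {μ : Measure Ω}

theorem coeFn_sum {p : ℝ≥0∞} {ι : Type*} (s : Finset ι) (f : ι → Lp ℝ p μ) :
    ⇑(∑ i ∈ s, f i) =ᵐ[μ] fun ω => ∑ i ∈ s, f i ω := by
  classical
  induction s using Finset.induction_on with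
  | empty =>
    simp only [Finset.sum_empty]
    exact Lp.coeFn_zero ℝ p μ
  | insert i s hi ih =>
    rw [Finset.sum_insert hi]
    filter_upwards [Lp.coeFn_add (f i) (∑ j ∈ s, f j), ih] with ω h1 h2
    rw [h1, Pi.add_apply, h2, Finset.sum_insert hi]

theorem ae_abs_le_norm (Y : Lp ℝ ∞ μ) : ∀ᵐ ω ∂μ, |Y ω| ≤ ‖Y‖ := by
  filter_upwards [ae_le_eLpNormEssSup (f := Y) (μ := μ)] with ω hω
  rw [Lp.norm_def, eLpNorm_exponent_top, ← Real.norm_eq_abs, ← toReal_enorm]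
  refine ENNReal.toReal_mono ?_ hω
  rw [← eLpNorm_exponent_top]
  exact Lp.eLpNorm_ne_top Y

theorem integral_cond_eq [IsProbabilityMeasure μ] (G : Set Ω) (f : Ω → ℝ) :
    ∫ ω, f ω ∂μ[|G] = (μ.real G)⁻¹ * ∫ ω in G, f ω ∂μ := by
  rw [ProbabilityTheory.cond, integral_smul_measure, ENNReal.toReal_inv, smul_eq_mul]
  rfl

variable [IsProbabilityMeasure μ]

/-- A convex law-invariant set contains, with `Y`, an element that agrees with `Y` off `G` and is
on `G` almost dominated by the mean of `Y` over `G`. -/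
theorem exists_mem_le_mean (hμ : IsNonatomic μ) {A : Set (Lp ℝ ∞ μ)} (hconv : Convex ℝ A)
    (hlaw : IsLawInvariant A) {Y : Lp ℝ ∞ μ} (hY : Y ∈ A) {G : Set Ω} (hG : MeasurableSet G)
    (hG0 : μ G ≠ 0) {δ : ℝ} (hδ : 0 < δ) :
    ∃ Z ∈ A, (∀ᵐ ω ∂μ, ω ∉ G → Z ω = Y ω) ∧
      ∀ᵐ ω ∂μ, ω ∈ G → Z ω ≤ ∫ ω, Y ω ∂μ[|G] + δ := by
  obtain ⟨N, hN⟩ := exists_nat_gt (2 * ‖Y‖ / δ)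
  have hN0' : (0 : ℝ) < N := lt_of_le_of_lt (by positivity) hN
  have hN0 : 0 < N := by exact_mod_cast hN0'
  obtain ⟨Z, hZlaw, hZG, hZle⟩ := exists_rearrangements hμ hG hG0
    (Lp.stronglyMeasurable Y).measurable (a := -‖Y‖) (b := ‖Y‖)
    ((ae_abs_le_norm Y).mono fun ω h => abs_le.1 h) hN0
  have hZmem : ∀ j : Fin N, MemLp (Z j) ∞ μ := fun j =>
    (hZlaw j j.2).memLp_iff.2 (Lp.memLp Y)
  set W : Fin N → Lp ℝ ∞ μ := fun j => (hZmem j).toLp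
  have hWZ : ∀ᵐ ω ∂μ, ∀ j, W j ω = Z j ω := ae_all_iff.2 fun j => (hZmem j).coeFn_toLp
  have hWA : ∀ j, W j ∈ A := fun j => by
    refine hlaw _ Y hY (IdentDistrib.trans ?_ (hZlaw j j.2))
    exact IdentDistrib.of_ae_eq (Lp.stronglyMeasurable _).measurable.aemeasurable
      (hZmem j).coeFn_toLp
  have hval : ∀ᵐ ω ∂μ, (∑ j, (1 / N : ℝ) • W j) ω =
      (1 / N : ℝ) * ∑ j ∈ Finset.range N, Z j ω := by
    have hs : ∀ᵐ ω ∂μ, ∀ j, ((1 / N : ℝ) • W j : Lp ℝ ∞ μ) ω = (1 / N : ℝ) * W j ω :=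
      ae_all_iff.2 fun j => Lp.coeFn_smul _ _
    filter_upwards [coeFn_sum Finset.univ fun j => (1 / N : ℝ) • W j, hs, hWZ] with ω h1 h2 h3
    rw [h1, Finset.mul_sum, Finset.sum_range]
    exact Finset.sum_congr rfl fun j _ => by rw [h2, h3]
  refine ⟨∑ j, (1 / N : ℝ) • W j, hconv.sum_mem (fun _ _ => by positivity) ?_ fun j _ => hWA j,
    ?_, ?_⟩
  · simp [hN0'.ne']
  · filter_upwards [hval] with ω h hω
    rw [h, Finset.sum_congr rfl fun j _ => hZG j ω hω]
    simp [hN0'.ne']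
  · filter_upwards [hval] with ω h hω
    have h2 : 2 * ‖Y‖ ≤ N * δ := ((div_lt_iff₀ hδ).1 hN).le
    rw [h, one_div, inv_mul_le_iff₀ hN0']
    linarith [hZle ω hω]

/-- The replacement of `exists_mem_le_mean`, carried out on finitely many disjoint events in turn;
on events not yet treated the means are still those of `Y`. -/
theorem exists_mem_le_means (hμ : IsNonatomic μ) {A : Set (Lp ℝ ∞ μ)} (hconv : Convex ℝ A)
    (hlaw : IsLawInvariant A) {Y : Lp ℝ ∞ μ} (hY : Y ∈ A) {ι : Type*} {G : ι → Set Ω}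
    (hG : ∀ i, MeasurableSet (G i)) (hdisj : Pairwise (Function.onFun Disjoint G)) {δ : ℝ}
    (hδ : 0 < δ) (s : Finset ι) :
    ∃ Z ∈ A, (∀ᵐ ω ∂μ, (∀ i ∈ s, ω ∉ G i) → Z ω = Y ω) ∧
      ∀ i ∈ s, ∀ᵐ ω ∂μ, ω ∈ G i → Z ω ≤ ∫ ω, Y ω ∂μ[|G i] + δ := by
  classical
  induction s using Finset.induction_on with
  | empty => exact ⟨Y, hY, by simp, by simp⟩
  | insert i s hi ih =>
    obtain ⟨Z, hZA, hZY, hZle⟩ := ih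
    by_cases hGi : μ (G i) = 0
    · refine ⟨Z, hZA, ?_, fun j hj => ?_⟩
      · filter_upwards [hZY] with ω h hω
        exact h fun j hj => hω j (Finset.mem_insert_of_mem hj)
      · rcases Finset.mem_insert.1 hj with rfl | hj
        · filter_upwards [measure_eq_zero_iff_ae_notMem.1 hGi] with ω h h'
          exact absurd h' h
        · exact hZle j hj
    · obtain ⟨Z', hZ'A, hZ'Z, hZ'le⟩ := exists_mem_le_mean hμ hconv hlaw hZA (hG i) hGi hδ
      have hoff : ∀ j ∈ s, ∀ ω ∈ G j, ω ∉ G i := fun j hj ω hω h =>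
        Set.disjoint_left.1 (hdisj fun hij : j = i => hi (hij ▸ hj)) hω h
      have hmean : ∫ ω, Z ω ∂μ[|G i] = ∫ ω, Y ω ∂μ[|G i] := by
        refine integral_congr_ae ?_
        filter_upwards [cond_absolutelyContinuous.ae_le hZY, ae_cond_mem (hG i)] with ω h hω
        exact h fun j hj hωj => hoff j hj ω hωj hω
      refine ⟨Z', hZ'A, ?_, fun j hj => ?_⟩
      · filter_upwards [hZY, hZ'Z] with ω h h' hω
        rw [h' (hω i (Finset.mem_insert_self i s)),
          h fun j hj => hω j (Finset.mem_insert_of_mem hj)]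
      · rcases Finset.mem_insert.1 hj with rfl | hj
        · rwa [hmean] at hZ'le
        · filter_upwards [hZle j hj, hZ'Z] with ω h h' hω
          rw [h' (hoff j hj ω hω)]
          exact h hω

theorem integral_abs_sub_le_dist {p : ℝ≥0∞} [Fact (1 ≤ p)] (X Y : Lp ℝ ∞ μ) :
    ∫ ω, |X ω - Y ω| ∂μ ≤ dist (inclLp μ p X) (inclLp μ p Y) := by
  have hp : (1 : ℝ≥0∞) ≤ p := Fact.out
  have hm : AEStronglyMeasurable (fun ω => X ω - Y ω) μ :=
    (Lp.aestronglyMeasurable X).sub (Lp.aestronglyMeasurable Y)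
  have h1 : ∫ ω, |X ω - Y ω| ∂μ = (eLpNorm (fun ω => X ω - Y ω) 1 μ).toReal := by
    rw [eLpNorm_one_eq_lintegral_enorm, ← integral_norm_eq_lintegral_enorm hm]
    rfl
  have h2 : (inclLp μ p X - inclLp μ p Y : Lp ℝ p μ) =ᵐ[μ] fun ω => X ω - Y ω :=
    Lp.coeFn_sub _ _
  rw [h1, dist_eq_norm, Lp.norm_def, eLpNorm_congr_ae h2]
  refine ENNReal.toReal_mono ?_ (eLpNorm_le_eLpNorm_of_exponent_le hp hm)
  rw [← eLpNorm_congr_ae h2]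
  exact Lp.eLpNorm_ne_top _

/-- For a convex law-invariant acceptance set, closure in `L^p` adds no bounded random variable
that is not in the closure in `L^∞`. If `Y ∈ A` is close to `X` in `L^p`, then the means of
`Y` over the cells `{i ε ≤ X < (i + 1) ε}` of positive probability are close to those of `X`,
hence to `X` itself, and `A` contains an element almost dominated by these means. -/
theorem mem_closure_of_incl_mem_closureLp (hμ : IsNonatomic μ) {A : Set (Lp ℝ ∞ μ)}
    (hA : IsAcceptanceSet A) (hconv : Convex ℝ A) (hlaw : IsLawInvariant A) {p : ℝ≥0∞}
    [Fact (1 ≤ p)] {X : Lp ℝ ∞ μ} (hX : inclLp μ p X ∈ closureLp p A) : X ∈ closure A := by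
  rw [Metric.mem_closure_iff]
  intro ε' hε'
  obtain ⟨ε, hε, hεε'⟩ : ∃ ε : ℝ, 0 < ε ∧ 3 * ε < ε' := ⟨ε' / 4, by linarith, by linarith⟩
  have hXm : Measurable X := (Lp.stronglyMeasurable X).measurable
  set G : ℤ → Set Ω := fun i => {ω | ⌊X ω / ε⌋ = i}
  have hG : ∀ i, MeasurableSet (G i) := fun i =>
    (hXm.div_const ε).floor (measurableSet_singleton i)
  have hdisj : Pairwise (Function.onFun Disjoint G) := fun i j hij =>
    Set.disjoint_left.2 fun ω (h : ⌊X ω / ε⌋ = i) (h' : ⌊X ω / ε⌋ = j) => hij (h.symm.trans h')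
  set s : Finset ℤ := Finset.Icc ⌊-‖X‖ / ε⌋ ⌊‖X‖ / ε⌋
  have hcover : ∀ᵐ ω ∂μ, ⌊X ω / ε⌋ ∈ s := by
    filter_upwards [ae_abs_le_norm X] with ω hω
    have := abs_le.1 hω
    exact Finset.mem_Icc.2 ⟨Int.floor_le_floor (by gcongr; exact this.1),
      Int.floor_le_floor (by gcongr; exact this.2)⟩
  obtain ⟨η, hη, hηs⟩ : ∃ η : ℝ, 0 < η ∧ ∀ i ∈ s, μ (G i) ≠ 0 → η ≤ μ.real (G i) := by
    have hev : ∀ᶠ η in 𝓝[>] (0 : ℝ), ∀ i ∈ s, μ (G i) ≠ 0 → η ≤ μ.real (G i) := by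
      refine (Finset.eventually_all s).2 fun i _ => ?_
      by_cases hi : μ (G i) = 0
      · exact Eventually.of_forall fun η h => absurd hi h
      · have hpos : 0 < μ.real (G i) := ENNReal.toReal_pos hi (measure_ne_top _ _)
        filter_upwards [Ioo_mem_nhdsGT hpos] with η h _
        exact h.2.le
    obtain ⟨η, h1, h2⟩ := (hev.and self_mem_nhdsWithin).exists
    exact ⟨η, h2, h1⟩
  obtain ⟨_, ⟨Y, hYA, rfl⟩, hXY⟩ := Metric.mem_closure_iff.1 hX (ε * η) (by positivity)
  have hL1 : ∫ ω, |Y ω - X ω| ∂μ ≤ ε * η := by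
    rw [dist_comm] at hXY
    exact (integral_abs_sub_le_dist Y X).trans hXY.le
  have hXi : Integrable X μ := (Lp.memLp X).integrable le_top
  have hYi : Integrable Y μ := (Lp.memLp Y).integrable le_top
  have hmean : ∀ i ∈ s, μ (G i) ≠ 0 → ∫ ω, Y ω ∂μ[|G i] ≤ (i + 2) * ε := by
    intro i hi hi0
    have hpos : 0 < μ.real (G i) := ENNReal.toReal_pos hi0 (measure_ne_top _ _)
    have h1 : ∫ ω in G i, X ω ∂μ ≤ ∫ _ in G i, ((i + 1) * ε) ∂μ := by
      refine setIntegral_mono_on hXi.integrableOn (integrable_const _).integrableOn (hG i) ?_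
      intro ω hω
      have h := Int.lt_floor_add_one (X ω / ε)
      rw [show ⌊X ω / ε⌋ = i from hω, div_lt_iff₀ hε] at h
      exact h.le
    have h2 : ∫ ω in G i, (Y ω - X ω) ∂μ ≤ ε * η :=
      calc ∫ ω in G i, (Y ω - X ω) ∂μ ≤ ∫ ω in G i, |Y ω - X ω| ∂μ :=
            setIntegral_mono_on (hYi.sub hXi).integrableOn (hYi.sub hXi).abs.integrableOn (hG i)
              fun ω _ => le_abs_self _
        _ ≤ ∫ ω, |Y ω - X ω| ∂μ :=
            setIntegral_le_integral (hYi.sub hXi).abs (Eventually.of_forall fun _ => abs_nonneg _)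
        _ ≤ ε * η := hL1
    rw [integral_sub hYi.integrableOn hXi.integrableOn] at h2
    rw [setIntegral_const, smul_eq_mul] at h1
    have h3 : ε * η ≤ ε * μ.real (G i) := by gcongr; exact hηs i hi hi0
    rw [integral_cond_eq, inv_mul_le_iff₀ hpos]
    linarith
  obtain ⟨Z, hZA, -, hZle⟩ := exists_mem_le_means hμ hconv hlaw hYA hG hdisj hε s
  have hZ : ∀ᵐ ω ∂μ, ∀ i ∈ s, ω ∈ G i → Z ω ≤ (i + 3) * ε := by
    refine (Finset.eventually_all s).2 fun i hi => ?_
    by_cases hi0 : μ (G i) = 0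
    · filter_upwards [measure_eq_zero_iff_ae_notMem.1 hi0] with ω h h'
      exact absurd h' h
    · filter_upwards [hZle i hi] with ω h hω
      linarith [h hω, hmean i hi hi0]
  refine ⟨X + Lp.const ∞ μ (3 * ε), hA.mem_of_le hZA ?_, ?_⟩
  · rw [← Lp.coeFn_le]
    filter_upwards [hZ, hcover, Lp.coeFn_add X (Lp.const ∞ μ (3 * ε)),
      Lp.coeFn_const (p := ∞) (μ := μ) (c := 3 * ε)] with ω h1 h2 h3 h4
    rw [h3, Pi.add_apply, h4, Function.const_apply]
    have h5 := h1 _ h2 rfl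
    have h6 := (le_div_iff₀ hε).1 (Int.floor_le (X ω / ε))
    linarith
  · rw [dist_eq_norm, sub_add_cancel_left, norm_neg]
    refine (Lp.norm_const_le ∞ μ (3 * ε)).trans_lt ?_
    simpa [abs_of_pos hε] using hεε'

end Closure

/-! ### The extended risk measure on `L^p` -/

section Extension

variable {Ω : Type*} [MeasurableSpace Ω] {μ : Measure Ω}

theorem closure_subset_riskMeasure_nonpos {A : Set (Lp ℝ ∞ μ)} {S₀ : ℝ} {ST : Lp ℝ ∞ μ}
    (hcont : Continuous (riskMeasure A S₀ ST)) :
    closure A ⊆ {X | riskMeasure A S₀ ST X ≤ 0} :=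
  closure_minimal
    (fun X hX => riskMeasure_le_of_mem (m := 0) (by simpa using hX))
    (isClosed_le hcont continuous_const)

section Inclusion

variable [IsFiniteMeasure μ]

theorem inclLp_smul (p : ℝ≥0∞) (c : ℝ) (X : Lp ℝ ∞ μ) :
    inclLp μ p (c • X) = c • inclLp μ p X := rfl

theorem inclLp_injective (p : ℝ≥0∞) : Function.Injective (inclLp μ p) := fun _ _ h =>
  Subtype.ext (congrArg (fun Z : Lp ℝ p μ => (Z : Ω →ₘ[μ] ℝ)) h)

theorem inclLp_nonneg {p : ℝ≥0∞} {X : Lp ℝ ∞ μ} (h : 0 ≤ X) : 0 ≤ inclLp μ p X := h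

theorem denseRange_inclLp {p : ℝ≥0∞} [Fact (1 ≤ p)] (hp : p ≠ ∞) :
    DenseRange (inclLp μ p) := by
  refine (Lp.simpleFunc.dense (E := ℝ) (μ := μ) hp).mono fun f hf => ?_
  have hg := (Lp.simpleFunc.toSimpleFunc ⟨f, hf⟩).memLp_of_isFiniteMeasure ∞ μ
  refine ⟨hg.toLp, ?_⟩
  have h : (inclLp μ p hg.toLp : Ω → ℝ) =ᵐ[μ] f :=
    hg.coeFn_toLp.trans (Lp.simpleFunc.toSimpleFunc_eq_toFun ⟨f, hf⟩)
  exact Lp.ext h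

end Inclusion

variable [IsProbabilityMeasure μ]

theorem norm_inclLp_le (p : ℝ≥0∞) [Fact (1 ≤ p)] (X : Lp ℝ ∞ μ) : ‖inclLp μ p X‖ ≤ ‖X‖ := by
  rw [Lp.norm_def, Lp.norm_def]
  exact ENNReal.toReal_mono (Lp.eLpNorm_ne_top X)
    (eLpNorm_le_eLpNorm_of_exponent_le le_top (Lp.aestronglyMeasurable X))

theorem continuous_inclLp (p : ℝ≥0∞) [Fact (1 ≤ p)] : Continuous (inclLp μ p) :=
  AddMonoidHomClass.continuous_of_bound (inclLp μ p) 1 fun X => by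
    simpa using norm_inclLp_le p X

theorem IsTradedAsset.inclLp {S₀ : ℝ} {ST : Lp ℝ ∞ μ} (hS : IsTradedAsset S₀ ST) (p : ℝ≥0∞) :
    IsTradedAsset S₀ (inclLp μ p ST) where
  price_pos := hS.price_pos
  payoff_nonneg := inclLp_nonneg hS.payoff_nonneg
  payoff_ne_zero h := hS.payoff_ne_zero (inclLp_injective p (h.trans (map_zero _).symm))

theorem convex_closureLp {p : ℝ≥0∞} [Fact (1 ≤ p)] {A : Set (Lp ℝ ∞ μ)} (hconv : Convex ℝ A) :
    Convex ℝ (closureLp p A) := by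
  refine Convex.closure ?_
  rintro _ ⟨X, hX, rfl⟩ _ ⟨Y, hY, rfl⟩ a b ha hb hab
  exact ⟨a • X + b • Y, hconv hX hY ha hb hab, by rw [map_add, inclLp_smul, inclLp_smul]⟩

variable (hμ : IsNonatomic μ) {A : Set (Lp ℝ ∞ μ)} (hA : IsAcceptanceSet A)
  (hconv : Convex ℝ A) (hlaw : IsLawInvariant A) {S₀ : ℝ} {ST : Lp ℝ ∞ μ}
  (hS : IsTradedAsset S₀ ST) (hfin : IsFiniteValued (riskMeasure A S₀ ST))
  {p : ℝ≥0∞} [Fact (1 ≤ p)]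

include hμ hA hconv hlaw hS hfin

theorem isAcceptanceSet_closureLp (hp : p ≠ ∞) : IsAcceptanceSet (closureLp p A) where
  nonempty := (hA.nonempty.image _).closure
  proper h := by
    obtain ⟨r, hr⟩ := hfin.exists_real
    have hcont := continuous_riskMeasure_of_finite hA hconv hS hfin
    have h1 := add_le_riskMeasure_sub A ST 0 (1 - r 0) (r 0) (hr 0).ge
    have h2 := closure_subset_riskMeasure_nonpos hcont (mem_closure_of_incl_mem_closureLp hμ hA
      hconv hlaw (p := p) (X := 0 - ((1 - r 0) / S₀) • ST) (h ▸ Set.mem_univ _))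
    have h3 : ((r 0 + (1 - r 0) : ℝ) : EReal) ≤ ((0 : ℝ) : EReal) := h1.trans h2
    have h4 := EReal.coe_le_coe_iff.1 h3
    linarith
  add_mem X hX Z hZ := by
    -- Both `X` and `Z` are limits of bounded random variables, the latter of positive ones.
    refine Metric.mem_closure_iff.2 fun ε hε => ?_
    obtain ⟨_, ⟨X', hX', rfl⟩, hXX'⟩ := Metric.mem_closure_iff.1 hX (ε / 2) (by positivity)
    obtain ⟨Z', hZZ'⟩ := (denseRange_inclLp (μ := μ) hp).exists_dist_lt Z
      (by positivity : 0 < ε / 2)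
    refine ⟨_, ⟨X' + Z' ⊔ 0, hA.add_mem X' hX' _ le_sup_right, rfl⟩, ?_⟩
    have h1 : dist Z (inclLp μ p (Z' ⊔ 0)) ≤ dist Z (inclLp μ p Z') := by
      rw [dist_eq_norm, dist_eq_norm]
      have := norm_sup_sub_sup_le_norm Z (inclLp μ p Z') 0
      rwa [sup_eq_left.2 hZ] at this
    rw [map_add]
    exact (dist_add_add_le _ _ _ _).trans_lt (by linarith)

/-- The risk measure of the `L^p`-closure extends the original one. -/
theorem riskMeasure_closureLp_inclLp (X : Lp ℝ ∞ μ) :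
    riskMeasure (closureLp p A) S₀ (inclLp μ p ST) (inclLp μ p X) = riskMeasure A S₀ ST X := by
  have hcont := continuous_riskMeasure_of_finite hA hconv hS hfin
  obtain ⟨r, hr⟩ := hfin.exists_real
  refine le_antisymm (le_iInf₂ fun m hm => riskMeasure_le_of_mem ?_) (le_iInf₂ fun m hm => ?_)
  · exact subset_closure ⟨X + (m / S₀) • ST, hm, by rw [map_add, inclLp_smul]⟩
  · have hm' : inclLp μ p (X + (m / S₀) • ST) ∈ closureLp p A := by
      rw [map_add, inclLp_smul]; exact hm
    have h1 := closure_subset_riskMeasure_nonpos hcont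
      (mem_closure_of_incl_mem_closureLp hμ hA hconv hlaw hm')
    have h2 := add_le_riskMeasure_sub A ST X (-m) (r X) (hr X).ge
    rw [neg_div, neg_smul, sub_neg_eq_add] at h2
    have h3 : ((r X + -m : ℝ) : EReal) ≤ ((0 : ℝ) : EReal) := h2.trans h1
    have h4 := EReal.coe_le_coe_iff.1 h3
    rw [hr]
    exact_mod_cast (by linarith : r X ≤ m)

/-- If the `L^p`-closure of `A` has an interior point, its risk measure is finite-valued: it is
finite on `L^∞` and bounded above on a ball, and each element of `L^p` is the midpoint of an
element of `L^∞` and an element of that ball. -/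
theorem isFiniteValued_riskMeasure_closureLp (hp : p ≠ ∞)
    (hint : (interior (closureLp p A)).Nonempty) :
    IsFiniteValued (riskMeasure (closureLp p A) S₀ (inclLp μ p ST)) := by
  have hB := isAcceptanceSet_closureLp hμ hA hconv hlaw hS hfin hp
  have hBc : Convex ℝ (closureLp p A) := convex_closureLp hconv
  have hext := riskMeasure_closureLp_inclLp hμ hA hconv hlaw hS hfin (p := p)
  obtain ⟨r, hr⟩ := hfin.exists_real
  obtain ⟨Y, hY⟩ := (denseRange_inclLp (μ := μ) hp).exists_mem_open isOpen_interior hint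
  obtain ⟨ε, hε, hball⟩ := Metric.mem_nhds_iff.1 (mem_interior_iff_mem_nhds.1 hY)
  have htop : ∀ X, ∃ m : ℝ, riskMeasure (closureLp p A) S₀ (inclLp μ p ST) X < m := by
    intro X
    obtain ⟨X', hX'⟩ := (denseRange_inclLp (μ := μ) hp).exists_dist_lt X
      (by positivity : 0 < ε / 2)
    have h1 : riskMeasure (closureLp p A) S₀ (inclLp μ p ST)
        (inclLp μ p Y + (2 : ℝ) • (X - inclLp μ p X')) < (1 : ℝ) := by
      refine (riskMeasure_le_of_mem (m := 0) ?_).trans_lt (by exact_mod_cast zero_lt_one)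
      rw [zero_div, zero_smul, add_zero]
      refine hball ?_
      rw [mem_ball_iff_norm, add_sub_cancel_left, norm_smul, Real.norm_ofNat, ← dist_eq_norm]
      linarith
    have h2 : riskMeasure (closureLp p A) S₀ (inclLp μ p ST)
        (inclLp μ p ((2 : ℝ) • X' - Y)) < (r ((2 : ℝ) • X' - Y) + 1 : ℝ) := by
      rw [hext, hr]
      exact_mod_cast lt_add_one _
    have h3 := riskMeasure_combo_lt hB hBc (hS.inclLp p) h1 h2 (a := 1 / 2) (b := 1 / 2)
      (by norm_num) (by norm_num) (by norm_num)
    have h4 : (1 / 2 : ℝ) • (inclLp μ p Y + (2 : ℝ) • (X - inclLp μ p X')) +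
        (1 / 2 : ℝ) • inclLp μ p ((2 : ℝ) • X' - Y) = X := by
      rw [map_sub, inclLp_smul]
      module
    rw [h4] at h3
    exact ⟨_, h3.trans_lt (EReal.coe_lt_coe_iff.2 (lt_add_one _))⟩
  refine fun X => ⟨fun hbot => ?_, fun h => ?_⟩
  · -- The value `-∞` at `X` would propagate to the midpoint `0` of `X` and `-X`.
    obtain ⟨n, hn⟩ := htop (-X)
    have h1 : riskMeasure (closureLp p A) S₀ (inclLp μ p ST) X < (2 * r 0 - n - 1 : ℝ) := by
      rw [hbot]; exact EReal.bot_lt_coe _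
    have h2 := riskMeasure_combo_lt hB hBc (hS.inclLp p) h1 hn (a := 1 / 2) (b := 1 / 2)
      (by norm_num) (by norm_num) (by norm_num)
    rw [smul_neg, add_neg_cancel, ← map_zero (inclLp μ p), hext, hr] at h2
    have h3 := EReal.coe_le_coe_iff.1 h2
    linarith
  · obtain ⟨m, hm⟩ := htop X
    rw [h] at hm
    exact not_top_lt hm

theorem isFiniteContinuousExtension_closureLp (hp : p ≠ ∞)
    (hint : (interior (closureLp p A)).Nonempty) :
    IsFiniteContinuousExtension (riskMeasure A S₀ ST)
      (riskMeasure (closureLp p A) S₀ (inclLp μ p ST)) := by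
  have hB := isAcceptanceSet_closureLp hμ hA hconv hlaw hS hfin hp
  have hBfin := isFiniteValued_riskMeasure_closureLp hμ hA hconv hlaw hS hfin hp hint
  exact ⟨⟨_, _, _, hB, hS.inclLp p, rfl⟩, hBfin,
    continuous_riskMeasure_of_finite hB (convex_closureLp hconv) (hS.inclLp p) hBfin,
    riskMeasure_closureLp_inclLp hμ hA hconv hlaw hS hfin⟩

end Extension

/-! ### Interior points in the `L^p`-topology -/

section LpInterior

variable {Ω : Type*} [MeasurableSpace Ω] {μ : Measure Ω} [IsProbabilityMeasure μ]
  {A : Set (Lp ℝ ∞ μ)} {p : ℝ≥0∞} [Fact (1 ≤ p)]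

theorem nhds_lpTopology (X : Lp ℝ ∞ μ) :
    @nhds _ (lpTopology μ p) X = comap (inclLp μ p) (𝓝 (inclLp μ p X)) :=
  @nhds_induced _ _ _ (inclLp μ p) X

theorem mem_lpTopology_interior {s : Set (Lp ℝ ∞ μ)} {X : Lp ℝ ∞ μ} :
    X ∈ @interior _ (lpTopology μ p) s ↔ s ∈ comap (inclLp μ p) (𝓝 (inclLp μ p X)) := by
  rw [← nhds_lpTopology]
  exact @mem_interior_iff_mem_nhds _ (lpTopology μ p) _ _

/-- If `ρ` is continuous at `0` for the `L^p`-norm, then `ρ < ρ 0 + 1` near `0`, so that shifting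
by the payoff of `ρ 0 + 1` units of capital gives an interior point of the acceptance set. -/
theorem lpTopology_interior_nonempty (hA : IsAcceptanceSet A) {S₀ : ℝ} {ST : Lp ℝ ∞ μ}
    (hS : IsTradedAsset S₀ ST) (hfin : IsFiniteValued (riskMeasure A S₀ ST))
    (hcont : ∀ X : ℕ → Lp ℝ ∞ μ, Tendsto (fun n => inclLp μ p (X n)) atTop (𝓝 0) →
      Tendsto (fun n => riskMeasure A S₀ ST (X n)) atTop (𝓝 (riskMeasure A S₀ ST 0))) :
    (@interior _ (lpTopology μ p) (closure A)).Nonempty := by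
  obtain ⟨r, hr⟩ := hfin.exists_real
  have htend : Tendsto (riskMeasure A S₀ ST) (comap (inclLp μ p) (𝓝 0))
      (𝓝 (riskMeasure A S₀ ST 0)) :=
    tendsto_of_seq_tendsto fun X hX => hcont X (tendsto_comap_iff.1 hX)
  have hlt : riskMeasure A S₀ ST 0 < (r 0 + 1 : ℝ) := by
    rw [hr]; exact_mod_cast lt_add_one _
  obtain ⟨V, hV, hVsub⟩ := mem_comap.1 (htend.eventually (gt_mem_nhds hlt))
  obtain ⟨ε, hε, hball⟩ := Metric.mem_nhds_iff.1 hV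
  set X₀ : Lp ℝ ∞ μ := ((r 0 + 1) / S₀) • ST
  refine ⟨X₀, mem_lpTopology_interior.2
    (mem_comap.2 ⟨_, Metric.ball_mem_nhds _ hε, fun X hX => subset_closure ?_⟩)⟩
  have h1 : X - X₀ ∈ inclLp μ p ⁻¹' V := by
    refine hball ?_
    rw [mem_ball_zero_iff, map_sub, ← dist_eq_norm]
    exact hX
  have h2 := mem_of_riskMeasure_lt hA hS (hVsub h1)
  rwa [sub_add_cancel] at h2

theorem IsFiniteContinuousExtension.tendsto_zero {ρ : Lp ℝ ∞ μ → EReal} {f : Lp ℝ p μ → EReal}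
    (hf : IsFiniteContinuousExtension ρ f) {X : ℕ → Lp ℝ ∞ μ}
    (hX : Tendsto (fun n => inclLp μ p (X n)) atTop (𝓝 0)) :
    Tendsto (fun n => ρ (X n)) atTop (𝓝 (ρ 0)) := by
  simp only [← hf.extends_on, map_zero]
  exact (hf.continuous.tendsto 0).comp hX

theorem interior_closureLp_nonempty (hp : p ≠ ∞)
    (h : (@interior _ (lpTopology μ p) (closure A)).Nonempty) :
    (interior (closureLp p A)).Nonempty := by
  obtain ⟨X, hX⟩ := h
  obtain ⟨V, hV, hVsub⟩ := mem_comap.1 (mem_lpTopology_interior.1 hX)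
  obtain ⟨V', hV'V, hV'o, hXV'⟩ := mem_nhds_iff.1 hV
  refine ⟨inclLp μ p X, mem_interior.2 ⟨V', ?_, hV'o, hXV'⟩⟩
  refine ((denseRange_inclLp hp).open_subset_closure_inter hV'o).trans ?_
  refine closure_minimal ?_ isClosed_closure
  rintro _ ⟨hY, ⟨Y, rfl⟩⟩
  exact image_closure_subset_closure_image (continuous_inclLp p) ⟨Y, hVsub (hV'V hY), rfl⟩

end LpInterior

end LawInvariantRisk

theorem theorem4p3 {Ω : Type*} [MeasurableSpace Ω] (μ : Measure Ω) [IsProbabilityMeasure μ]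
    (hμ : LawInvariantRisk.IsNonatomic μ)
    (A : Set (Lp ℝ ∞ μ)) (hA : LawInvariantRisk.IsAcceptanceSet A)
    (hconv : Convex ℝ A) (hlaw : LawInvariantRisk.IsLawInvariant A)
    (S₀ : ℝ) (ST : Lp ℝ ∞ μ) (hS : LawInvariantRisk.IsTradedAsset S₀ ST)
    (hfin : LawInvariantRisk.IsFiniteValued (LawInvariantRisk.riskMeasure A S₀ ST)) :
    Continuous (LawInvariantRisk.riskMeasure A S₀ ST) ∧
    ∀ (p : ℝ≥0∞) [Fact (1 ≤ p)], p ≠ ∞ →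
      -- finite-valued risk measures on `L^p` with convex acceptance set are continuous
      (∀ (B : Set (Lp ℝ p μ)) (R₀ : ℝ) (RT : Lp ℝ p μ),
        LawInvariantRisk.IsAcceptanceSet B → Convex ℝ B →
        LawInvariantRisk.IsTradedAsset R₀ RT →
        LawInvariantRisk.IsFiniteValued (LawInvariantRisk.riskMeasure B R₀ RT) →
        Continuous (LawInvariantRisk.riskMeasure B R₀ RT)) ∧
      -- the four equivalent conditions
      List.TFAE [
        ∃ f : Lp ℝ p μ → EReal, LawInvariantRisk.IsFiniteContinuousExtension
          (LawInvariantRisk.riskMeasure A S₀ ST) f,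
        ∀ X : ℕ → Lp ℝ ∞ μ,
          Tendsto (fun n => LawInvariantRisk.inclLp μ p (X n)) atTop (𝓝 0) →
          Tendsto (fun n => LawInvariantRisk.riskMeasure A S₀ ST (X n)) atTop
            (𝓝 (LawInvariantRisk.riskMeasure A S₀ ST 0)),
        (@interior (Lp ℝ ∞ μ) (LawInvariantRisk.lpTopology μ p) (closure A)).Nonempty,
        (interior (LawInvariantRisk.closureLp p A)).Nonempty] ∧
      -- uniqueness of the extension, and the formula for it
      ((∃ f : Lp ℝ p μ → EReal, LawInvariantRisk.IsFiniteContinuousExtension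
          (LawInvariantRisk.riskMeasure A S₀ ST) f) →
        ∀ f : Lp ℝ p μ → EReal,
          LawInvariantRisk.IsFiniteContinuousExtension
            (LawInvariantRisk.riskMeasure A S₀ ST) f ↔
          f = LawInvariantRisk.riskMeasure (LawInvariantRisk.closureLp p A) S₀
            (LawInvariantRisk.inclLp μ p ST)) := by
  open LawInvariantRisk in
  refine ⟨continuous_riskMeasure_of_finite hA hconv hS hfin, fun p _ hp => ⟨?_, ?_, ?_⟩⟩
  · exact fun B R₀ RT hB hBc hR hBfin => continuous_riskMeasure_of_finite hB hBc hR hBfin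
  · tfae_have 1 → 2 := fun ⟨f, hf⟩ X hX => hf.tendsto_zero hX
    tfae_have 2 → 3 := lpTopology_interior_nonempty hA hS hfin
    tfae_have 3 → 4 := interior_closureLp_nonempty hp
    tfae_have 4 → 1 := fun hint =>
      ⟨_, isFiniteContinuousExtension_closureLp hμ hA hconv hlaw hS hfin hp hint⟩
    tfae_finish
  · rintro ⟨g, hg⟩ f
    have hint : (interior (closureLp p A)).Nonempty := interior_closureLp_nonempty hp
      (lpTopology_interior_nonempty hA hS hfin fun X hX => hg.tendsto_zero hX)
    have hext := isFiniteContinuousExtension_closureLp hμ hA hconv hlaw hS hfin hp hint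
    refine ⟨fun hf => ?_, fun hf => hf ▸ hext⟩
    -- Continuous extensions agree, because `L^∞` is dense in `L^p`.
    refine (denseRange_inclLp hp).equalizer hf.continuous hext.continuous (funext fun X => ?_)
    exact (hf.extends_on X).trans (hext.extends_on X).symm
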